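/- Let $A$ be a principal ideal domain. Call a prime ideal $\mathfrak p$ of $A$ real if $-1$ is not a sum of squares in $A/\mathfrak p$, and call an irreducible $q\in A$ non-real if the prime ideal $(q)$ is not real. Let ${\rm Spec_r}A$ be the real spectrum of $A$, i.e. the set of all pairs $\alpha=(\mathfrak p,\le_\alpha)$ where $\mathfrak p$ is a real prime ideal of $A$ and $\le_\alpha$ is a (total, ring) ordering of $A/\mathfrak p$; for $a\in A$ write $a>_\alpha 0$ (resp. $a\ge_\alpha 0$) if the class of $a$ in $A/\mathfrak p$ is $>0$ (resp. $\ge 0$) for $\le_\alpha$. Assume that $A$ satisfies (PNRI) every non-real irreducible $q\in A$ is associated to a non-real irreducible $q'$ such that $q'>_\alpha 0$ for all $\alpha\in{\rm Spec_r}A$. Let $M\in A^{n\times n}$ be a symmetric matrix which is positive semi-definite on ${\rm Spec_r}A$, i.e. such that for every ring morphism $\phi:A\to R$ into a real closed field $R$ the matrix $\phi(M)$ is positive semi-definite. Let ${\rm diag}(d_1,\dots,d_r,0,\dots,0)$, with $d_1,\dots,d_r\in A$ nonzero and $d_1\mid d_2\mid\dots\mid d_r$, be the Smith normal form of $M$,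 i.e. $M=P\,{\rm diag}(d_1,\dots,d_r,0,\dots,0)\,Q$ with $P,Q\in A^{n\times n}$ invertible over $A$. Then, for every $k=1,\dots,r$, the element $d_k$ is associated to an element $d'_k\in A$ such that $d'_k\ge_\alpha 0$ for all $\alpha\in{\rm Spec_r}A$. -/

import Mathlib

universe u

/-- A prime ideal `p` of `A` is real if `A ⧸ p` is formally real, i.e. `-1` is not a sum of
squares in `A ⧸ p` (this is what Mathlib calls `IsSemireal`). -/
def IsRealPrime {A : Type u} [CommRing A] (p : Ideal A) : Prop :=
  p.IsPrime ∧ IsSemireal (A ⧸ p)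

/-- A point of the real spectrum of `A`: a real prime ideal `supp` of `A` together with a (total,
ring) ordering on `A ⧸ supp`. -/
structure RealSpec (A : Type u) [CommRing A] where
  /-- The support of the point. -/
  supp : Ideal A
  isRealPrime : IsRealPrime supp
  /-- The ordering on the quotient by the support. -/
  order : LinearOrder (A ⧸ supp)
  isStrictOrderedRing : @IsStrictOrderedRing (A ⧸ supp) _ order.toPartialOrder

/-- `a ≥ 0` at the point `α` of the real spectrum. -/
def RealSpec.Nonneg {A : Type u} [CommRing A] (α : RealSpec A) (a : A) : Prop :=
  α.order.le 0 (Ideal.Quotient.mk α.supp a)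

/-- `a > 0` at the point `α` of the real spectrum. -/
def RealSpec.Pos {A : Type u} [CommRing A] (α : RealSpec A) (a : A) : Prop :=
  α.order.lt 0 (Ideal.Quotient.mk α.supp a)

/-- A non-real irreducible: an irreducible element which does not generate a real prime ideal. -/
def IsNonRealIrreducible {A : Type u} [CommRing A] (q : A) : Prop :=
  Irreducible q ∧ ¬ IsRealPrime (Ideal.span {q})

/-- Condition (PNRI), positivity of non-real irreducibles: every non-real irreducible is associated
to a non-real irreducible which is strictly positive at every point of the real spectrum. -/
def PNRI (A : Type u) [CommRing A] : Prop :=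
  ∀ q : A, IsNonRealIrreducible q →
    ∃ q' : A, Associated q q' ∧ IsNonRealIrreducible q' ∧ ∀ α : RealSpec A, α.Pos q'

/-- A square matrix `M` over `A` (meant to be symmetric) is positive semidefinite on the real
spectrum of `A`: for every ring morphism `φ` from `A` to a real closed field `R`, with its (unique)
ordering, the quadratic form of `φ(M)` takes nonnegative values on `Rⁿ`. -/
def PsdOnRealSpec {A : Type u} [CommRing A] {n : ℕ} (M : Matrix (Fin n) (Fin n) A) : Prop :=
  ∀ (R : Type u) [Field R] [LinearOrder R] [IsStrictOrderedRing R] [IsRealClosed R]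
    (φ : A →+* R) (x : Fin n → R), 0 ≤ x ⬝ᵥ ((M.map φ).mulVec x)

/-- Equivalence of square matrices: `M = P N Q` with `P`, `Q` invertible over `A`. -/
def MatrixEquivalent {A : Type u} [CommRing A] {n : ℕ} (M N : Matrix (Fin n) (Fin n) A) : Prop :=
  ∃ P Q : Matrix (Fin n) (Fin n) A, IsUnit P.det ∧ IsUnit Q.det ∧ M = P * N * Q

/-- The `n × n` matrix `diag(d₁, …, d_r, 0, …, 0)`. -/
def diagPad {A : Type u} [CommRing A] (n : ℕ) {r : ℕ} (d : Fin r → A) :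
    Matrix (Fin n) (Fin n) A :=
  Matrix.diagonal fun i : Fin n => if h : (i : ℕ) < r then d ⟨i, h⟩ else 0

/-- `diag(d₁, …, d_r, 0, …, 0)` is the Smith normal form of `M`: the `d_k` are nonzero, they divide
each other successively, and the diagonal matrix is equivalent to `M`. -/
structure IsSmithNormalForm {A : Type u} [CommRing A] {n r : ℕ} (M : Matrix (Fin n) (Fin n) A)
    (d : Fin r → A) : Prop where
  le : r ≤ n
  ne_zero : ∀ k, d k ≠ 0
  dvd : ∀ j k, j ≤ k → d j ∣ d k
  equiv : MatrixEquivalent M (diagPad n d)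

open Polynomial IntermediateField

/-! The point is that each `d k` has even order at every real prime `q`. Real primes then contribute
squares to `d k`, and (PNRI) replaces each non-real irreducible factor by a positive associate.

For the parity, suppose `d k = q ^ (2m+1) * c` with `q ∤ c`. Symmetry and Smith form give vectors
`v`, `w` on which the bilinear form is `d k`, while the quadratic form takes values `d k * a` and `d
k * b`. A value of the form with odd order at `q` would be negative in some real closed field
(`IsRealPrime.exists_map_neg`), so `q` divides `a` and `b`. At `v + w` it likewise divides `a + b +
2`. Hence `q ∣ 2`, impossible at a real prime.

For the negativity of an element `f` of odd order, sums of squares in `A` have even order at `q`, so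
`1 + s = f * t` is unsolvable in sums of squares of the fraction field. Hence adjoining `√(-f)`
keeps that field formally real, and Artin–Schreier theory embeds the result in a real closed field.
-/

theorem IsSumSq.map_ringHom {R S : Type*} [Semiring R] [Semiring S] (φ : R →+* S) {s : R}
    (hs : IsSumSq s) : IsSumSq (φ s) := by
  induction hs with
  | zero => simp
  | sq_add a _ ih => simpa using IsSumSq.sq_add (φ a) ih

theorem IsSumSq.inv {F : Type*} [Field F] {s : F} (hs : IsSumSq s) : IsSumSq s⁻¹ := by
  have h : s⁻¹ = s * (s⁻¹ * s⁻¹) := by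
    rcases eq_or_ne s 0 with rfl | h
    · simp
    · field_simp
  rw [h]
  exact hs.mul (IsSumSq.mul_self _)

theorem IsSemireal.add_eq_zero_left {F : Type*} [Field F] [IsSemireal F] {s t : F}
    (hs : IsSumSq s) (ht : IsSumSq t) (h : s + t = 0) : s = 0 := by
  by_contra hs0
  refine IsSemireal.one_add_ne_zero (ht.mul hs.inv) ?_
  rw [← div_eq_mul_inv, ← div_self hs0, ← add_div, h, zero_div]

theorem IsSemireal.of_ringHom {R S : Type*} [Semiring R] [Semiring S] (φ : R →+* S)
    [IsSemireal S] : IsSemireal R where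
  one_add_ne_zero hs h := by
    refine IsSemireal.one_add_ne_zero (hs.map_ringHom φ) ?_
    rw [← map_one φ, ← map_add, h, map_zero]

/-! ### Artin–Schreier: maximal formally real fields are real closed -/

section Extensions

variable {F C : Type*} [Field F] [Field C] [Algebra F C]

theorem exists_eq_add_mul_of_mem_adjoin_sqrt {a : F} {z : C} (hz : z * z = algebraMap F C a)
    {e : C} (he : e ∈ F⟮z⟯) : ∃ x y : F, e = algebraMap F C x + algebraMap F C y * z := by
  have hint : IsIntegral F z := by
    refine ⟨X ^ 2 - Polynomial.C a, monic_X_pow_sub_C a two_ne_zero, ?_⟩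
    simp [pow_two, hz]
  rw [← mem_toSubalgebra, adjoin_simple_toSubalgebra_of_isAlgebraic hint.isAlgebraic] at he
  induction he using Algebra.adjoin_induction with
  | mem x hx => exact ⟨0, 1, by simpa using hx⟩
  | algebraMap r => exact ⟨r, 0, by simp⟩
  | add u v _ _ hu hv =>
    obtain ⟨x, y, rfl⟩ := hu
    obtain ⟨x', y', rfl⟩ := hv
    exact ⟨x + x', y + y', by simp only [map_add]; ring⟩
  | mul u v _ _ hu hv =>
    obtain ⟨x, y, rfl⟩ := hu
    obtain ⟨x', y', rfl⟩ := hv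
    refine ⟨x * x' + a * (y * y'), x * y' + x' * y, ?_⟩
    simp only [map_add, map_mul]
    linear_combination (algebraMap F C y * algebraMap F C y') * hz

/-- If adjoining a new square root of `a` destroys formal reality, then `-1` is of the
form `s + a * t` with sums of squares `s` and `t`. -/
theorem exists_isSumSq_of_not_isSemireal_adjoin_sqrt {a : F} {z : C}
    (hz : z * z = algebraMap F C a) (hzF : z ∉ Set.range (algebraMap F C))
    (h : ¬ IsSemireal F⟮z⟯) :
    ∃ s t : F, IsSumSq s ∧ IsSumSq t ∧ 1 + s + a * t = 0 := by
  have key : ∀ e : F⟮z⟯, IsSumSq e → ∃ s t p : F, IsSumSq s ∧ IsSumSq t ∧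
      (e : C) = algebraMap F C (s + a * t) + algebraMap F C p * z := by
    intro e he
    induction he with
    | zero => exact ⟨0, 0, 0, .zero, .zero, by simp⟩
    | sq_add b _ ih =>
      obtain ⟨s, t, p, hs, ht, h⟩ := ih
      obtain ⟨x, y, hb⟩ := exists_eq_add_mul_of_mem_adjoin_sqrt hz b.2
      refine ⟨x * x + s, y * y + t, p + 2 * x * y, .sq_add x hs, .sq_add y ht, ?_⟩
      push_cast
      rw [hb, h]
      simp only [map_add, map_mul, map_ofNat]
      linear_combination (algebraMap F C y * algebraMap F C y) * hz
  rw [isSemireal_iff_not_isSumSq_neg_one, not_not] at h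
  obtain ⟨s, t, p, hs, ht, h⟩ := key _ h
  refine ⟨s, t, hs, ht, ?_⟩
  -- Otherwise the equation could be solved for `z`, which would lie in `F`.
  have hp : p = 0 := by
    by_contra hp
    refine hzF ⟨-(1 + (s + a * t)) / p, ?_⟩
    have hp' : algebraMap F C p ≠ 0 := by simpa using hp
    simp only [map_neg, map_div₀, map_one, map_add, map_mul] at h ⊢
    push_cast at h
    field_simp
    linear_combination h
  apply (algebraMap F C).injective
  simp only [hp, map_add, map_mul, map_one, map_zero, zero_mul] at h ⊢
  push_cast at h
  linear_combination -h

/-- Lifts `-1 = ∑ bᵢ²` from `F⟮z⟯` to polynomials. Reducing the lifts modulo the minimal polynomial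
gives the degree bound on which the descent for odd-degree polynomials rests. -/
theorem exists_sum_of_squares_of_not_isSemireal_adjoin {z : C} (hz : IsIntegral F z)
    (h : ¬ IsSemireal F⟮z⟯) :
    ∃ G ∈ AddSubmonoid.closure {p : F[X] | ∃ g : F[X], p = g * g ∧
      g.natDegree < (minpoly F z).natDegree}, aeval z (1 + G) = 0 := by
  have hmem : ∀ b : F⟮z⟯, ∃ g : F[X], g.natDegree < (minpoly F z).natDegree ∧
      (b : C) = aeval z g := by
    intro b
    have hb := b.2
    rw [← mem_toSubalgebra, adjoin_simple_toSubalgebra_of_isAlgebraic hz.isAlgebraic,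
      Algebra.adjoin_singleton_eq_range_aeval] at hb
    obtain ⟨g, hg⟩ := hb
    refine ⟨g %ₘ minpoly F z, natDegree_modByMonic_lt _ (minpoly.monic hz) (minpoly.ne_one F z), ?_⟩
    rw [aeval_modByMonic_eq_self_of_root (minpoly.aeval F z)]
    exact hg.symm
  have key : ∀ e : F⟮z⟯, IsSumSq e → ∃ G ∈ AddSubmonoid.closure {p : F[X] | ∃ g : F[X],
      p = g * g ∧ g.natDegree < (minpoly F z).natDegree}, (e : C) = aeval z G := by
    intro e he
    induction he with
    | zero => exact ⟨0, zero_mem _, by simp⟩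
    | sq_add b _ ih =>
      obtain ⟨G, hG, h⟩ := ih
      obtain ⟨g, hg, hb⟩ := hmem b
      refine ⟨g * g + G, add_mem (AddSubmonoid.subset_closure ⟨g, rfl, hg⟩) hG, ?_⟩
      push_cast
      rw [h, hb, map_add, map_mul]
  rw [isSemireal_iff_not_isSumSq_neg_one, not_not] at h
  obtain ⟨G, hG, h⟩ := key _ h
  refine ⟨G, hG, ?_⟩
  rw [map_add, ← h]
  simp

/-- Leading coefficients are sums of squares, so over a formally real field they cannot cancel when
squares are added. -/
theorem natDegree_even_and_le_of_mem_closure_squares [IsSemireal F] {n : ℕ} {G : F[X]}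
    (hG : G ∈ AddSubmonoid.closure {p : F[X] | ∃ g : F[X], p = g * g ∧ g.natDegree < n}) :
    Even G.natDegree ∧ G.natDegree ≤ 2 * (n - 1) ∧ IsSumSq G.leadingCoeff := by
  induction hG using AddSubmonoid.closure_induction with
  | mem p hp =>
    obtain ⟨g, rfl, hg⟩ := hp
    rw [← pow_two, natDegree_pow, pow_two, leadingCoeff_mul]
    exact ⟨even_two_mul _, by omega, .mul_self _⟩
  | zero => simp
  | add p q _ _ hp hq =>
    rcases lt_trichotomy p.degree q.degree with h | h | h
    · rwa [natDegree_add_eq_right_of_degree_lt h, leadingCoeff_add_of_degree_lt h]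
    · by_cases hp0 : p = 0
      · simpa [hp0] using hq
      have hne : p.leadingCoeff + q.leadingCoeff ≠ 0 := fun h0 =>
        hp0 (leadingCoeff_eq_zero.mp (IsSemireal.add_eq_zero_left hp.2.2 hq.2.2 h0))
      rw [leadingCoeff_add_of_degree_eq h hne]
      have hd : (p + q).natDegree = p.natDegree :=
        natDegree_eq_of_degree_eq ((degree_add_eq_of_leadingCoeff_add_ne_zero hne).trans
          (by rw [h, max_self]))
      rw [hd]
      exact ⟨hp.1, hp.2.1, hp.2.2.add hq.2.2⟩
    · rwa [natDegree_add_eq_left_of_degree_lt h, leadingCoeff_add_of_degree_lt' h]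

variable [IsSemireal F] [IsAlgClosed C]

theorem IsSumSq.isSquare_of_isSemireal_maximal
    (hmax : ∀ z : C, IsSemireal F⟮z⟯ → z ∈ Set.range (algebraMap F C)) {s : F}
    (hs : IsSumSq s) : IsSquare s := by
  obtain ⟨z, hz⟩ := IsAlgClosed.exists_eq_mul_self (algebraMap F C s)
  by_cases hzF : z ∈ Set.range (algebraMap F C)
  · obtain ⟨x, rfl⟩ := hzF
    exact ⟨x, (algebraMap F C).injective (by simpa using hz)⟩
  obtain ⟨u, t, hu, ht, h⟩ :=
    exists_isSumSq_of_not_isSemireal_adjoin_sqrt hz.symm hzF (mt (hmax z) hzF)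
  rw [add_assoc] at h
  exact absurd h (IsSemireal.one_add_ne_zero (hu.add (hs.mul ht)))

theorem isSquare_or_isSquare_neg_of_isSemireal_maximal
    (hmax : ∀ z : C, IsSemireal F⟮z⟯ → z ∈ Set.range (algebraMap F C)) (a : F) :
    IsSquare a ∨ IsSquare (-a) := by
  obtain ⟨z, hz⟩ := IsAlgClosed.exists_eq_mul_self (algebraMap F C a)
  by_cases hzF : z ∈ Set.range (algebraMap F C)
  · obtain ⟨x, rfl⟩ := hzF
    exact .inl ⟨x, (algebraMap F C).injective (by simpa using hz)⟩
  obtain ⟨s, t, hs, ht, h⟩ :=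
    exists_isSumSq_of_not_isSemireal_adjoin_sqrt hz.symm hzF (mt (hmax z) hzF)
  have ht0 : t ≠ 0 := by
    rintro rfl
    exact IsSemireal.one_add_ne_zero hs (by simpa using h)
  have ha : -a = (1 + s) * t⁻¹ := by
    field_simp
    linear_combination -h
  refine .inr (IsSumSq.isSquare_of_isSemireal_maximal hmax ?_)
  rw [ha]
  exact (IsSumSq.one.add hs).mul ht.inv

/-- Descent on the degree. For a root `z` outside `F`, either the cofactor of its minimal polynomial
in `f` has smaller odd degree, or the minimal polynomial is odd and divides some `1 + G` with `G` a
sum of squares. In the latter case the quotient has smaller odd degree, hence a root, although `1 +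
G` has none. -/
theorem exists_isRoot_of_odd_natDegree_of_isSemireal_maximal
    (hmax : ∀ z : C, IsSemireal F⟮z⟯ → z ∈ Set.range (algebraMap F C)) {f : F[X]}
    (hf : Odd f.natDegree) : ∃ x, f.IsRoot x := by
  induction hn : f.natDegree using Nat.strong_induction_on generalizing f with
  | h n ih =>
  have hf0 : f.natDegree ≠ 0 := fun h => by simp [h] at hf
  obtain ⟨z, hz⟩ := IsAlgClosed.exists_aeval_eq_zero C f
    (fun h => hf0 (natDegree_eq_zero_iff_degree_le_zero.mpr h.le))
  have hfne : f ≠ 0 := by rintro rfl; simp at hf0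
  have hint : IsIntegral F z := isAlgebraic_iff_isIntegral.mp ⟨f, hfne, hz⟩
  by_cases hzF : z ∈ Set.range (algebraMap F C)
  · obtain ⟨x, rfl⟩ := hzF
    refine ⟨x, (algebraMap F C).injective ?_⟩
    rwa [aeval_algebraMap_apply, coe_aeval_eq_eval, ← map_zero (algebraMap F C)] at hz
  obtain ⟨g, hg⟩ := minpoly.dvd F z hz
  have hm0 := minpoly.ne_zero hint
  have hg0 : g ≠ 0 := by rintro rfl; simp [hfne] at hg
  have hdeg : f.natDegree = (minpoly F z).natDegree + g.natDegree := by
    rw [hg, natDegree_mul hm0 hg0]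
  have hmpos := minpoly.natDegree_pos hint
  rcases Nat.even_or_odd (minpoly F z).natDegree with hev | hodd
  · obtain ⟨x, hx⟩ := ih g.natDegree (by omega) (by grind) rfl
    exact ⟨x, by rw [hg]; exact root_mul_left_of_isRoot _ hx⟩
  obtain ⟨G, hG, hG0⟩ := exists_sum_of_squares_of_not_isSemireal_adjoin hint (mt (hmax z) hzF)
  obtain ⟨h, hh⟩ := minpoly.dvd F z hG0
  have h1G : 1 + G ∈ AddSubmonoid.closure {p : F[X] | ∃ g : F[X], p = g * g ∧
      g.natDegree < (minpoly F z).natDegree} :=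
    add_mem (AddSubmonoid.subset_closure ⟨1, by simp, by simpa using hmpos⟩) hG
  have heval : ∀ x : F, IsSumSq (G.eval x) := by
    intro x
    clear hG0 hh h1G
    induction hG using AddSubmonoid.closure_induction with
    | mem p hp => obtain ⟨g, rfl, -⟩ := hp; simp
    | zero => simp
    | add p q _ _ hp hq => rw [eval_add]; exact hp.add hq
  have hne : ∀ x : F, (1 + G).eval x ≠ 0 := fun x => by
    rw [eval_add, eval_one]; exact IsSemireal.one_add_ne_zero (heval x)
  have hh0 : h ≠ 0 := by
    rintro rfl
    exact hne 0 (by simp [hh])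
  obtain ⟨heven, hle, -⟩ := natDegree_even_and_le_of_mem_closure_squares h1G
  rw [hh, natDegree_mul hm0 hh0] at heven hle
  obtain ⟨x, hx⟩ := ih h.natDegree (by omega) (by grind) rfl
  exact absurd (by rw [hh]; exact root_mul_left_of_isRoot _ hx) (hne x)

theorem IsRealClosed.of_isSemireal_maximal
    (hmax : ∀ z : C, IsSemireal F⟮z⟯ → z ∈ Set.range (algebraMap F C)) : IsRealClosed F where
  isSquare_or_isSquare_neg := isSquare_or_isSquare_neg_of_isSemireal_maximal hmax
  exists_isRoot_of_odd_natDegree := exists_isRoot_of_odd_natDegree_of_isSemireal_maximal hmax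

end Extensions

/-! ### Embedding formally real fields into real closed fields -/

theorem isSemireal_sSup_of_isChain {K C : Type*} [Field K] [Field C] [Algebra K C]
    {c : Set (IntermediateField K C)} (hc : IsChain (· ≤ ·) c) (hne : c.Nonempty)
    (h : ∀ E ∈ c, IsSemireal E) : IsSemireal (sSup c : IntermediateField K C) := by
  have : Nonempty c := hne.to_subtype
  have hmem : ∀ x : C, x ∈ sSup c → ∃ E ∈ c, x ∈ E := by
    intro x hx
    rw [sSup_eq_iSup', ← SetLike.mem_coe, coe_iSup_of_directed hc.directedOn.directed_val] at hx
    simpa using hx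
  have key : ∀ s : (sSup c : IntermediateField K C), IsSumSq s →
      ∃ E ∈ c, ∃ t : E, IsSumSq t ∧ (t : C) = s := by
    intro s hs
    induction hs with
    | zero => exact ⟨hne.some, hne.some_mem, 0, .zero, by simp⟩
    | sq_add b _ ih =>
      obtain ⟨E, hE, t, ht, hts⟩ := ih
      obtain ⟨E', hE', hb⟩ := hmem b b.2
      obtain ⟨D, hD, hED, hED'⟩ := hc.directedOn E hE E' hE'
      refine ⟨D, hD, ⟨b, hED' hb⟩ * ⟨b, hED' hb⟩ + inclusion hED t,
        .sq_add _ (ht.map_ringHom (inclusion hED).toRingHom), ?_⟩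
      simp [hts]
  refine .of_not_isSumSq_neg_one fun hs => ?_
  obtain ⟨E, hE, t, ht, hts⟩ := key _ hs
  have := h E hE
  refine IsSemireal.one_add_ne_zero ht (Subtype.ext ?_)
  simp [hts]

/-- A formally real subextension of an algebraically closed extension lies in a real closed one. -/
theorem exists_isRealClosed_ge {K C : Type*} [Field K] [Field C] [Algebra K C] [IsAlgClosed C]
    (E : IntermediateField K C) (hE : IsSemireal E) :
    ∃ R : IntermediateField K C, E ≤ R ∧ IsRealClosed R := by
  obtain ⟨R, hER, hR⟩ := zorn_le_nonempty₀ {E : IntermediateField K C | IsSemireal E}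
    (fun c hcs hc y hy => ⟨sSup c, isSemireal_sSup_of_isChain hc ⟨y, hy⟩ hcs,
      fun z hz => le_sSup hz⟩) E hE
  have : IsSemireal R := hR.prop
  refine ⟨R, hER, IsRealClosed.of_isSemireal_maximal (C := C) fun z hz => ?_⟩
  have hle : R ≤ R⟮z⟯.restrictScalars K := fun x hx => R⟮z⟯.algebraMap_mem ⟨x, hx⟩
  -- Maximality over `K` forces `R⟮z⟯`, viewed as an extension of `K`, back into `R`.
  have := hR.le_of_ge (y := R⟮z⟯.restrictScalars K) hz hle
  exact ⟨⟨z, this (mem_adjoin_simple_self R z)⟩, rfl⟩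

/-- If `-1` is not of the form `s + a * t` with sums of squares `s`, `t`, then the field embeds
into a real closed field in which `a` is a square. -/
theorem exists_isRealClosed_isSquare {K : Type u} [Field K] {a : K}
    (h : ∀ s t : K, IsSumSq s → IsSumSq t → 1 + s + a * t ≠ 0) :
    ∃ (R : Type u) (_ : Field R) (_ : IsRealClosed R) (φ : K →+* R), IsSquare (φ a) := by
  have hK : IsSemireal K := ⟨fun {s} hs h0 => h s 0 hs .zero (by simpa using h0)⟩
  obtain ⟨z, hz⟩ := IsAlgClosed.exists_eq_mul_self (algebraMap K (AlgebraicClosure K) a)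
  by_cases hzK : z ∈ Set.range (algebraMap K (AlgebraicClosure K))
  · obtain ⟨x, rfl⟩ := hzK
    have hbot : IsSemireal (⊥ : IntermediateField K (AlgebraicClosure K)) :=
      .of_ringHom (botEquiv K (AlgebraicClosure K)).toRingEquiv.toRingHom
    obtain ⟨R, -, hR⟩ := exists_isRealClosed_ge _ hbot
    refine ⟨R, inferInstance, hR, algebraMap K R, algebraMap K R x, Subtype.ext ?_⟩
    exact hz
  · have hE : IsSemireal K⟮z⟯ := by
      by_contra hE
      obtain ⟨s, t, hs, ht, h0⟩ := exists_isSumSq_of_not_isSemireal_adjoin_sqrt hz.symm hzK hE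
      exact h s t hs ht h0
    obtain ⟨R, hER, hR⟩ := exists_isRealClosed_ge _ hE
    refine ⟨R, inferInstance, hR, algebraMap K R, ⟨z, hER (mem_adjoin_simple_self K z)⟩,
      Subtype.ext ?_⟩
    exact hz

/-- The sums of squares form the nonnegative cone: every element or its negative is a square, and
formal reality excludes both signs for a nonzero element. -/
theorem IsRealClosed.exists_linearOrder (R : Type*) [Field R] [IsRealClosed R] :
    ∃ _ : LinearOrder R, IsStrictOrderedRing R := by
  classical
  let P : RingCone R :=
    { Subsemiring.sumSq R with
      eq_zero_of_mem_of_neg_mem' := fun {a} ha hna =>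
        IsSemireal.add_eq_zero_left (by simpa using ha) (by simpa using hna) (add_neg_cancel a) }
  have hP : ∀ a : R, a ∈ P ∨ -a ∈ P := fun a =>
    (IsRealClosed.isSquare_or_isSquare_neg a).imp
      (fun h => Subsemiring.mem_sumSq.mpr h.isSumSq) (fun h => Subsemiring.mem_sumSq.mpr h.isSumSq)
  have : HasMemOrNegMem P := ⟨hP⟩
  let _ : LinearOrder R := LinearOrder.mkOfAddGroupCone P
  have := IsOrderedRing.mkOfCone P
  exact ⟨inferInstance, IsOrderedRing.toIsStrictOrderedRing R⟩

/-! ### Orders of sums of squares at real primes -/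

theorem IsSumSq.exists_clear_denominator {A K : Type*} [CommRing A] [IsDomain A] [Field K] [Algebra A K]
    [IsFractionRing A K] {s : K} (hs : IsSumSq s) :
    ∃ b S : A, b ≠ 0 ∧ IsSumSq S ∧ s * algebraMap A K (b * b) = algebraMap A K S := by
  induction hs with
  | zero => exact ⟨1, 0, one_ne_zero, .zero, by simp⟩
  | sq_add x _ ih =>
    obtain ⟨b, S, hb, hS, h⟩ := ih
    obtain ⟨u, v, hv, rfl⟩ := IsFractionRing.div_surjective (A := A) x
    have hv0 : v ≠ 0 := nonZeroDivisors.ne_zero hv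
    have hv1 : algebraMap A K v ≠ 0 := by simpa using hv0
    refine ⟨b * v, (u * b) * (u * b) + S * (v * v), mul_ne_zero hb hv0,
      .sq_add _ (hS.mul (.mul_self v)), ?_⟩
    simp only [map_mul, map_add] at h ⊢
    field_simp
    linear_combination (algebraMap A K v) ^ 2 * h

theorem IsRealPrime.not_dvd_two {A : Type u} [CommRing A] {q : A}
    (hr : IsRealPrime (Ideal.span {q})) : ¬ q ∣ 2 := by
  have := hr.2
  have := hr.1
  rw [← Ideal.mem_span_singleton, ← Ideal.Quotient.eq_zero_iff_mem, map_ofNat]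
  exact two_ne_zero

/-- The quotient by `(q)` is a formally real field, where a vanishing sum of squares has only zero
terms. -/
theorem IsRealPrime.dvd_of_dvd_mul_self_add {A : Type u} [CommRing A] [IsPrincipalIdealRing A]
    {q : A} (hq : Irreducible q) (hr : IsRealPrime (Ideal.span {q})) {a s : A} (hs : IsSumSq s) (h : q ∣ a * a + s) : q ∣ a := by
  have : (Ideal.span {q}).IsMaximal := PrincipalIdealRing.isMaximal_of_irreducible hq
  let _ : Field (A ⧸ Ideal.span {q}) := Ideal.Quotient.field _
  have := hr.2
  rw [← Ideal.mem_span_singleton, ← Ideal.Quotient.eq_zero_iff_mem] at h ⊢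
  rw [map_add, map_mul] at h
  exact mul_self_eq_zero.mp
    (IsSemireal.add_eq_zero_left (IsSumSq.mul_self _) (hs.map_ringHom _) h)

section RealPrime

variable {A : Type u} [CommRing A] [IsPrincipalIdealRing A] {q : A}

theorem IsRealPrime.exists_eq_of_dvd_isSumSq (hq : Irreducible q)
    (hr : IsRealPrime (Ideal.span {q})) {s : A} (hs : IsSumSq s) (h : q ∣ s) :
    ∃ t, IsSumSq t ∧ s = q * q * t := by
  induction hs with
  | zero => exact ⟨0, .zero, by simp⟩
  | sq_add a hs ih =>
    obtain ⟨b, rfl⟩ := hr.dvd_of_dvd_mul_self_add hq hs h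
    obtain ⟨t, ht, rfl⟩ := ih ((dvd_add_right (dvd_mul_of_dvd_left (dvd_mul_right q b) _)).mp h)
    exact ⟨b * b + t, .sq_add b ht, by ring⟩

variable [IsDomain A]

/-- An element of odd order at a real prime is not a quotient of two sums of squares. -/
theorem IsRealPrime.mul_self_add_ne (hq : Irreducible q) (hr : IsRealPrime (Ideal.span {q}))
    {c : A} (hc : ¬ q ∣ c) {a : A} (ha : a ≠ 0) (m : ℕ) {s t : A} (hs : IsSumSq s)
    (ht : IsSumSq t) : a * a + s ≠ q ^ (2 * m + 1) * c * t := by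
  -- Infinite descent: each step cancels `q²` from both sides and replaces `a` by `a / q`. The
  -- nonzero square `a * a` is kept apart from `s` to make this terminate.
  induction a using WellFounded.induction (wellFounded_dvdNotUnit (α := A)) generalizing m s t with
  | _ a ih =>
  intro h
  have hq0 : q * q ≠ 0 := mul_ne_zero hq.ne_zero hq.ne_zero
  have hdvd : q ∣ a * a + s := ⟨q ^ (2 * m) * c * t, by rw [h]; ring⟩
  obtain ⟨b, rfl⟩ := hr.dvd_of_dvd_mul_self_add hq hs hdvd
  obtain ⟨s, hs', rfl⟩ := hr.exists_eq_of_dvd_isSumSq hq hs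
    ((dvd_add_right (dvd_mul_of_dvd_left (dvd_mul_right q b) _)).mp hdvd)
  have hb := right_ne_zero_of_mul ha
  have hlt : DvdNotUnit b (q * b) := ⟨hb, q, hq.not_isUnit, mul_comm _ _⟩
  cases m with
  | zero =>
    -- Only one factor `q` is left on the right, so the second must come from `t`, which then yields
    -- `q²`; the exponent stays 1.
    have hct : q ∣ c * t := ⟨b * b + s, mul_left_cancel₀ hq.ne_zero (by linear_combination -h)⟩
    obtain ⟨t, ht', rfl⟩ :=
      hr.exists_eq_of_dvd_isSumSq hq ht ((hq.prime.dvd_or_dvd hct).resolve_left hc)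
    exact ih b hlt hb 0 hs' ht' (mul_left_cancel₀ hq0 (by linear_combination h))
  | succ m =>
    exact ih b hlt hb m hs' ht (mul_left_cancel₀ hq0 (by linear_combination h))

/-- An element of odd order at a real prime becomes negative under a morphism to some real closed
field. -/
theorem IsRealPrime.exists_map_neg (hq : Irreducible q) (hr : IsRealPrime (Ideal.span {q}))
    {c : A} (hc : ¬ q ∣ c) (m : ℕ) :
    ∃ (R : Type u) (_ : Field R) (_ : LinearOrder R) (_ : IsStrictOrderedRing R)
      (_ : IsRealClosed R) (φ : A →+* R), φ (q ^ (2 * m + 1) * c) < 0 := by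
  have hf0 : q ^ (2 * m + 1) * c ≠ 0 :=
    mul_ne_zero (pow_ne_zero _ hq.ne_zero) (by rintro rfl; simp at hc)
  -- Making `-f` a square makes `f` nonpositive, and injectivity on the fraction field makes it
  -- strictly negative.
  obtain ⟨R, _, _, φ, hφ⟩ := exists_isRealClosed_isSquare (K := FractionRing A)
    (a := -algebraMap A _ (q ^ (2 * m + 1) * c)) (by
      intro s t hs ht h
      obtain ⟨b, S, hb, hS, hbS⟩ := hs.exists_clear_denominator (A := A)
      obtain ⟨v, T, hv, hT, hvT⟩ := ht.exists_clear_denominator (A := A)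
      refine hr.mul_self_add_ne hq hc (mul_ne_zero hb hv) m (hS.mul (.mul_self v))
        (hT.mul (.mul_self b)) (IsFractionRing.injective A (FractionRing A) ?_)
      simp only [map_mul, map_add] at hbS hvT h ⊢
      rw [← hbS, ← hvT]
      linear_combination (algebraMap A (FractionRing A) b * algebraMap A _ v) ^ 2 * h)
  obtain ⟨_, _⟩ := IsRealClosed.exists_linearOrder R
  refine ⟨R, inferInstance, inferInstance, inferInstance, inferInstance,
    φ.comp (algebraMap A (FractionRing A)), lt_of_le_of_ne ?_ ?_⟩
  · have := hφ.nonneg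
    rw [map_neg] at this
    simpa only [RingHom.comp_apply] using neg_nonneg.mp this
  · rw [RingHom.comp_apply]
    simpa only [ne_eq, map_eq_zero, IsFractionRing.to_map_eq_zero_iff] using hf0

end RealPrime

/-! ### Invariant factors and values of the quadratic form -/

section Matrix

open Matrix

theorem Matrix.IsSymm.add_dotProduct_mulVec {A n : Type*} [CommRing A] [Fintype n]
    {M : Matrix n n A} (hM : M.IsSymm) (v w : n → A) :
    (v + w) ⬝ᵥ M *ᵥ (v + w) = v ⬝ᵥ M *ᵥ v + w ⬝ᵥ M *ᵥ w + 2 * (v ⬝ᵥ M *ᵥ w) := by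
  have h : w ⬝ᵥ M *ᵥ v = v ⬝ᵥ M *ᵥ w := by
    rw [dotProduct_comm, ← vecMul_transpose, hM.eq, ← dotProduct_mulVec]
  rw [mulVec_add, dotProduct_add, add_dotProduct, add_dotProduct, h]
  ring

/-- If a symmetric matrix is equivalent to a diagonal matrix with entry `c` at `k`, then there are
vectors `v`, `w` at which the bilinear form is `c`, such that both values of the quadratic form are
multiples of `c`. -/
theorem Matrix.IsSymm.exists_dotProduct_mulVec_eq_diagonal {A n : Type*} [CommRing A] [Fintype n]
    [DecidableEq n] {M P Q : Matrix n n A} (hM : M.IsSymm) (hP : IsUnit P.det)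
    (hQ : IsUnit Q.det) {D : n → A} (h : M = P * diagonal D * Q) (k : n) :
    ∃ v w : n → A, v ⬝ᵥ M *ᵥ w = D k ∧ D k ∣ v ⬝ᵥ M *ᵥ v ∧ D k ∣ w ⬝ᵥ M *ᵥ w := by
  let e : n → A := Pi.single k 1
  have he : diagonal D *ᵥ e = D k • e := by
    ext i
    rcases eq_or_ne i k with rfl | hi <;> simp_all [e, mulVec_diagonal]
  have hMw : M *ᵥ (Q⁻¹ *ᵥ e) = D k • (P *ᵥ e) := by
    rw [h, mulVec_mulVec, Matrix.mul_assoc, Matrix.mul_nonsing_inv _ hQ, Matrix.mul_one,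
      ← mulVec_mulVec, he, mulVec_smul]
  -- Symmetry enters here: `M = Mᵀ = Qᵀ D Pᵀ`, so `P⁻¹ᵀ` plays for `v` the role of `Q⁻¹` for `w`.
  have hMv : M *ᵥ (P⁻¹ᵀ *ᵥ e) = D k • (Qᵀ *ᵥ e) := by
    have hPP : Pᵀ * P⁻¹ᵀ = 1 := by
      rw [← transpose_mul, Matrix.nonsing_inv_mul _ hP, transpose_one]
    rw [← hM.eq, h, transpose_mul, transpose_mul, diagonal_transpose, mulVec_mulVec,
      Matrix.mul_assoc, Matrix.mul_assoc, hPP, Matrix.mul_one, ← mulVec_mulVec, he, mulVec_smul]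
  refine ⟨P⁻¹ᵀ *ᵥ e, Q⁻¹ *ᵥ e, ?_, ?_, ?_⟩
  · rw [hMw, dotProduct_smul, mulVec_transpose, ← dotProduct_mulVec, mulVec_mulVec,
      Matrix.nonsing_inv_mul _ hP]
    simp [e]
  · rw [hMv, dotProduct_smul]
    exact dvd_mul_right _ _
  · rw [hMw, dotProduct_smul]
    exact dvd_mul_right _ _

end Matrix

open Matrix in
theorem PsdOnRealSpec.dvd_of_dotProduct_mulVec_eq {A : Type u} [CommRing A] [IsDomain A]
    [IsPrincipalIdealRing A] {n : ℕ} {M : Matrix (Fin n) (Fin n) A} (hpsd : PsdOnRealSpec M)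
    {q : A} (hq : Irreducible q) (hr : IsRealPrime (Ideal.span {q})) {x : Fin n → A} {m : ℕ}
    {c : A} (hx : x ⬝ᵥ M *ᵥ x = q ^ (2 * m + 1) * c) : q ∣ c := by
  by_contra hc
  obtain ⟨R, _, _, _, _, φ, hφ⟩ := hr.exists_map_neg hq hc m
  have := hpsd R φ (φ ∘ x)
  rw [← hx, RingHom.map_dotProduct] at hφ
  have h2 : φ ∘ (M *ᵥ x) = M.map φ *ᵥ (φ ∘ x) := by
    ext i; exact RingHom.map_mulVec φ M x i
  rw [h2] at hφ
  exact absurd this hφ.not_ge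

/-- The invariant factors of a positive semidefinite symmetric matrix have even order at every
real prime. -/
theorem PsdOnRealSpec.dvd_of_smith_eq {A : Type u} [CommRing A] [IsDomain A]
    [IsPrincipalIdealRing A] {n r : ℕ} {M : Matrix (Fin n) (Fin n) A} (hpsd : PsdOnRealSpec M)
    (hM : M.IsSymm) {d : Fin r → A} (hd : IsSmithNormalForm M d) (k : Fin r)
    {q : A} (hq : Irreducible q) (hr : IsRealPrime (Ideal.span {q})) {m : ℕ} {c : A}
    (hk : d k = q ^ (2 * m + 1) * c) : q ∣ c := by
  obtain ⟨P, Q, hP, hQ, h⟩ := hd.equiv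
  obtain ⟨v, w, hvw, ⟨a, ha⟩, ⟨b, hb⟩⟩ :=
    hM.exists_dotProduct_mulVec_eq_diagonal hP hQ h (Fin.castLE hd.le k)
  have hD : (if h : ((Fin.castLE hd.le k : Fin n) : ℕ) < r then d ⟨_, h⟩ else 0) = d k := by
    simp
  rw [hD] at hvw ha hb
  have hs := hM.add_dotProduct_mulVec v w
  by_contra hc
  -- Such a value is `q ^ (2m+1) * (c * a)`; since `q ∤ c`, semidefiniteness puts `q` into `a`.
  have hval : ∀ (x : Fin n → A) (a : A), x ⬝ᵥ M.mulVec x = d k * a → q ∣ a := fun x a hx =>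
    (hq.prime.dvd_or_dvd (hpsd.dvd_of_dotProduct_mulVec_eq hq hr
      (by rw [hx, hk, mul_assoc]))).resolve_left hc
  -- The 2 is the cross term `2 * d k` of the polarization identity.
  have hab := hval (v + w) (a + b + 2) (by rw [hs, ha, hb, hvw]; ring)
  exact hr.not_dvd_two
    ((dvd_add_right (dvd_add (hval v a ha) (hval w b hb))).mp hab)

/-! ### Nonnegative associates from even orders -/

theorem RealSpec.nonneg_mul {A : Type u} [CommRing A] (α : RealSpec A) {a b : A}
    (ha : α.Nonneg a) (hb : α.Nonneg b) : α.Nonneg (a * b) := by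
  let _ := α.order
  have := α.isStrictOrderedRing
  unfold RealSpec.Nonneg at *
  rw [map_mul]
  exact mul_nonneg ha hb

theorem RealSpec.nonneg_mul_self {A : Type u} [CommRing A] (α : RealSpec A) (a : A) :
    α.Nonneg (a * a) := by
  let _ := α.order
  have := α.isStrictOrderedRing
  unfold RealSpec.Nonneg
  rw [map_mul]
  exact mul_self_nonneg _

theorem RealSpec.Pos.nonneg {A : Type u} [CommRing A] {α : RealSpec A} {a : A}
    (h : α.Pos a) : α.Nonneg a := by
  let _ := α.order
  exact le_of_lt h

/-- Under (PNRI), an element of even order at every real prime is associated to an element which is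
nonnegative on the real spectrum. -/
theorem PNRI.exists_associated_nonneg {A : Type u} [CommRing A] [IsDomain A]
    [IsPrincipalIdealRing A] (hA : PNRI A) {d : A} (hd0 : d ≠ 0)
    (hd : ∀ q : A, Irreducible q → IsRealPrime (Ideal.span {q}) →
      ∀ (m : ℕ) (c : A), d = q ^ (2 * m + 1) * c → q ∣ c) :
    ∃ d' : A, Associated d d' ∧ ∀ α : RealSpec A, α.Nonneg d' := by
  induction d using WellFounded.induction (wellFounded_dvdNotUnit (α := A)) with
  | _ d ih =>
  by_cases hu : IsUnit d
  · exact ⟨1, associated_one_iff_isUnit.mpr hu, fun α => by simpa using α.nonneg_mul_self 1⟩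
  obtain ⟨q, hq, b, rfl⟩ := WfDvdMonoid.exists_irreducible_factor hu hd0
  have hb0 := right_ne_zero_of_mul hd0
  by_cases hr : IsRealPrime (Ideal.span {q})
  -- Even order at `q` makes `q²` a factor; it is split off as a square.
  · obtain ⟨b, rfl⟩ := hd q hq hr 0 b (by ring)
    have hb0' := right_ne_zero_of_mul hb0
    obtain ⟨d', hd', hnn⟩ := ih b
      ⟨hb0', q * q, fun h => hq.not_isUnit (isUnit_of_mul_isUnit_left h), by ring⟩ hb0' (by
        rintro p hp hpr m c rfl
        have h1 := hd p hp hpr m (q * q * c) (by ring)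
        rcases hp.prime.dvd_or_dvd h1 with h2 | h2
        -- Here `p` is an associate of `q`, so restoring `q²` raises the order at `p` by two: the
        -- parity hypothesis is applied again with `m + 1`.
        · obtain ⟨v, rfl⟩ := hp.prime.dvd_of_dvd_pow (n := 2) (by rwa [pow_two])
          have hv : ¬ p ∣ v := fun hv => hp.not_isUnit
            (isUnit_of_dvd_unit hv ((hq.isUnit_or_isUnit rfl).resolve_left hp.not_isUnit))
          have h3 := hd p hp hpr (m + 1) (v * v * c) (by ring)
          refine (hp.prime.dvd_or_dvd h3).resolve_left fun h4 => ?_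
          exact (hp.prime.dvd_or_dvd h4).elim hv hv
        · exact h2)
    refine ⟨q * q * d', ?_, fun α => α.nonneg_mul (α.nonneg_mul_self q) (hnn α)⟩
    rw [← mul_assoc]
    exact hd'.mul_left _
  · obtain ⟨q', hqq', -, hpos⟩ := hA q ⟨hq, hr⟩
    obtain ⟨d', hd', hnn⟩ := ih b ⟨hb0, q, hq.not_isUnit, by ring⟩ hb0 (by
      rintro p hp hpr m c rfl
      -- A real `p` cannot divide the non-real irreducible `q`, since both would generate the same
      -- ideal.
      refine (hp.prime.dvd_or_dvd (hd p hp hpr m (q * c) (by ring))).resolve_left fun h => hr ?_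
      rwa [← Ideal.span_singleton_eq_span_singleton.mpr (hp.associated_of_dvd hq h)])
    exact ⟨q' * d', hqq'.mul_mul hd', fun α => α.nonneg_mul (hpos α).nonneg (hnn α)⟩

theorem mainTheorem2 {A : Type u} [CommRing A] [IsDomain A] [IsPrincipalIdealRing A]
    (hA : PNRI A) {n r : ℕ} (M : Matrix (Fin n) (Fin n) A) (hM : M.IsSymm)
    (hpsd : PsdOnRealSpec M) (d : Fin r → A) (hd : IsSmithNormalForm M d) (k : Fin r) :
    ∃ d' : A, Associated (d k) d' ∧ ∀ α : RealSpec A, α.Nonneg d' :=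
  hA.exists_associated_nonneg (hd.ne_zero k) fun _ hq hr _ _ h =>
    hpsd.dvd_of_smith_eq hM hd k hq hr h
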